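/- Let $n,n',d\in\mathbb{N}$ with $n,d\ge 1$ and let $\Phi=\{\phi_j\}_{j=1}^n$ be a set of patches, i.e. each $\phi_j:\mathbb{R}^d\to\mathbb{R}^{n'}$ has the form $\phi_j(\mathbf{x})=(x_{i^j_1},\ldots,x_{i^j_{n'}})$ with pairwise distinct indices $i^j_1,\ldots,i^j_{n'}\in\{1,\ldots,d\}$. A matrix $W\in\mathbb{R}^{n\times d}$ conforms to $\Phi$ if there is a vector $\mathbf{w}\in\mathbb{R}^{n'}$ such that $(W\mathbf{x})_j=\mathbf{w}^\top\phi_j(\mathbf{x})$ for all $\mathbf{x}\in\mathbb{R}^d$ and $j\in\{1,\ldots,n\}$. For $\sigma:\mathbb{R}\to\mathbb{R}$ (applied entrywise to vectors), $\rho:\mathbb{R}^n\to\mathbb{R}$ and $B>0$ let $$\mathcal{H}^{\sigma,\rho,\Phi}_{B,n,d}=\{\mathbf{x}\mapsto\rho(\sigma(W\mathbf{x})) : W\in\mathbb{R}^{n\times d},\ \|W\|\le B,\ W\text{ conforms to }\Phi\},$$ where $\|W\|$ is the spectral norm; for vectors $\|\cdot\|$ is the Euclidean norm. The Rademacher complexity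 of a class $\mathcal{F}$ of real functions on $m$ inputs from a set $\mathcal{X}$ is $$\mathcal{R}_m(\mathcal{F})=\sup_{\mathbf{x}_1,\ldots,\mathbf{x}_m\in\mathcal{X}}\mathbb{E}_{\boldsymbol{\epsilon}}\Big[\sup_{f\in\mathcal{F}}\frac1m\sum_{i=1}^m\epsilon_i f(\mathbf{x}_i)\Big],$$ with $\epsilon_1,\ldots,\epsilon_m$ independent and uniform on $\{-1,+1\}$. There is a universal constant $c>0$ such that the following holds. Suppose that $\sigma$ is $L$-Lipschitz with $\sigma(0)=0$, and that $\rho$ is $1$-Lipschitz with respect to $\ell_\infty$ with $\rho(\mathbf{0})=0$. Then for all $B,b_x,\epsilon>0$, all $n,d\ge 1$, all sets of patches $\Phi$ and all integers $m\ge 2$, the Rademacher complexity of $\mathcal{H}^{\sigma,\rho,\Phi}_{B,n,d}$ on $m$ inputs from $\{\mathbf{x}\in\mathbb{R}^d : \|\phi_j(\mathbf{x})\|\le b_x\text{ for all }j\in\{1,\ldots,n\}\}$ is at most $\epsilon$ if $$m\ \ge\ c\cdot\Big(\frac{LBb_x}{\epsilon}\Big)^2\cdot\log^2(m)\,\log(mn).$$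 Thus it suffices to have $m=\tilde{\mathcal{O}}\big((LBb_x/\epsilon)^2\big)$: there are universal constants $C>0$ and $k\in\mathbb{N}$ such that, with $A=(LBb_x/\epsilon)^2$ and under the same assumptions but for every integer $m\ge1$, the Rademacher complexity above is at most $\epsilon$ if $m\ge C\cdot A\cdot\log^k(2+A+n)$. -/

import Mathlib

open scoped NNReal Matrix

noncomputable section

/-- The patch with coordinates `p 0, …, p (n' - 1)` (pairwise distinct): the map
`x ↦ (x_{p 0}, …, x_{p (n' - 1)})` from `ℝ^d` to `ℝ^{n'}`. -/
def patchMap {d n' : ℕ} (p : Fin n' ↪ Fin d) (x : EuclideanSpace ℝ (Fin d)) :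
    EuclideanSpace ℝ (Fin n') :=
  WithLp.toLp 2 (fun k => x (p k))

/-- `W` conforms to the patches `Φ`: for some filter `w`, `(W x)_j = wᵀ φ_j(x)` for all `x`
and `j`. -/
def Conforms {n d n' : ℕ} (W : Matrix (Fin n) (Fin d) ℝ) (Φ : Fin n → Fin n' ↪ Fin d) : Prop :=
  ∃ w : EuclideanSpace ℝ (Fin n'), ∀ (x : EuclideanSpace ℝ (Fin d)) (j : Fin n),
    (W *ᵥ x.ofLp) j = inner ℝ w (patchMap (Φ j) x)

/-- The spectral norm of a matrix: the norm of `x ↦ W x` as an operator between Euclidean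
spaces. -/
def matrixSpectralNorm {n d : ℕ} (W : Matrix (Fin n) (Fin d) ℝ) : ℝ :=
  ‖LinearMap.toContinuousLinearMap (Matrix.toEuclideanLin W)‖

/-- The class of networks `x ↦ ρ (σ (W x))`, `σ` acting entrywise, with `‖W‖ ≤ B` and `W`
conforming to `Φ`. -/
def convClass {n d n' : ℕ} (σ : ℝ → ℝ) (ρ : (Fin n → ℝ) → ℝ) (Φ : Fin n → Fin n' ↪ Fin d)
    (B : ℝ) : Set (EuclideanSpace ℝ (Fin d) → ℝ) :=
  {h | ∃ W : Matrix (Fin n) (Fin d) ℝ, matrixSpectralNorm W ≤ B ∧ Conforms W Φ ∧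
    h = fun x => ρ (fun j => σ ((W *ᵥ x.ofLp) j))}

/-- The inputs all of whose patches have Euclidean norm at most `b`. -/
def patchBall {n d n' : ℕ} (Φ : Fin n → Fin n' ↪ Fin d) (b : ℝ) :
    Set (EuclideanSpace ℝ (Fin d)) :=
  {x | ∀ j, ‖patchMap (Φ j) x‖ ≤ b}

/-- The Rademacher complexity of `F` on `m` inputs from `S`: the supremum over
`x_1, …, x_m ∈ S` of the average over all sign vectors `s ∈ {-1, 1}^m` of
`sup_{f ∈ F} (1/m) ∑ i, s_i f(x_i)`. All suprema are taken in the extended reals, so an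
unbounded class has complexity `⊤`. -/
def rademacherComplexity {E : Type*} (F : Set (E → ℝ)) (S : Set E) (m : ℕ) : EReal :=
  ⨆ (x : Fin m → E) (_ : ∀ i, x i ∈ S),
    ((((2 : ℝ) ^ m)⁻¹ : ℝ) : EReal) * ∑ s : Fin m → ℤˣ,
      ⨆ f ∈ F, (((1 / (m : ℝ)) * ∑ i, ((s i : ℤ) : ℝ) * f (x i) : ℝ) : EReal)

end

/-! A conforming `W` has a filter `w` with `‖w‖ ≤ ‖W‖ ≤ B`, and the outputs on `m` inputs depend on
`w` only through the `m * n` inner products of `w` with the patches, in an `L`-Lipschitz way for the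
sup norm, because `ρ` is Lipschitz for `ℓ∞`. So what matters is covering linear functions on a ball,
in sup norm over `m * n` vectors of norm at most `b`. A perceptron argument
(`exists_word_or_decrease`) gives a cover at scale `B * b / 2 ^ k` of log-size `4 ^ k * log (3 * m *
n)`, whatever the dimension.

In the chaining (`exists_chaining_bound`) the growth `2 ^ k` of the root of the log-size cancels the
scale, so every level costs the same. About `log m` levels suffice, whence `log² m * log (m * n)`
after squaring. -/

/-! ### Massart's finite class lemma -/

/-- The average over sign vectors of the exponential of a Rademacher sum. -/
theorem sum_exp_signs_le {m : ℕ} (a : Fin m → ℝ) {c : ℝ} (ha : ∀ i, |a i| ≤ c) (t : ℝ) :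
    ((2 : ℝ) ^ m)⁻¹ * ∑ s : Fin m → ℤˣ, Real.exp (t * ∑ i, ((s i : ℤ) : ℝ) * a i) ≤
      Real.exp (t ^ 2 * c ^ 2 * m / 2) := by
  have hfac : ∑ s : Fin m → ℤˣ, Real.exp (t * ∑ i, ((s i : ℤ) : ℝ) * a i) =
      ∏ i, (2 * Real.cosh (t * a i)) := by
    have h1 : ∀ i, ∑ u : ℤˣ, Real.exp (t * (((u : ℤ) : ℝ) * a i)) = 2 * Real.cosh (t * a i) := by
      intro i
      rw [Real.cosh_eq, UnitsInt.univ, Finset.sum_pair (by decide)]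
      simp
      ring
    simp_rw [← h1, Finset.prod_univ_sum, Fintype.piFinset_univ, Finset.mul_sum, Real.exp_sum]
  rw [hfac, Finset.prod_mul_distrib]
  simp only [Finset.prod_const, Finset.card_univ, Fintype.card_fin]
  rw [inv_mul_cancel_left₀ (by positivity)]
  calc ∏ i, Real.cosh (t * a i) ≤ ∏ _i : Fin m, Real.exp (t ^ 2 * c ^ 2 / 2) := by
        refine Finset.prod_le_prod (fun i _ => (Real.cosh_pos _).le) fun i _ => ?_
        refine (Real.cosh_le_exp_half_sq _).trans (Real.exp_le_exp.2 ?_)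
        have h2 : a i ^ 2 ≤ c ^ 2 := sq_le_sq' (abs_le.1 (ha i)).1 (abs_le.1 (ha i)).2
        have := mul_le_mul_of_nonneg_left h2 (sq_nonneg t)
        rw [mul_pow]
        linarith
    _ = Real.exp (t ^ 2 * c ^ 2 * m / 2) := by
        rw [Finset.prod_const, ← Real.exp_nat_mul]
        simp
        ring_nf

/-- Massart's finite class lemma, before optimizing over the parameter `t`. -/
theorem massart_aux {m : ℕ} (A : Finset (Fin m → ℝ)) (hA : A.Nonempty) {c q t : ℝ}
    (hc : ∀ a ∈ A, ∀ i, |a i| ≤ c) (hq : (A.card : ℝ) ≤ Real.exp q) (ht : 0 < t) :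
    ((2 : ℝ) ^ m)⁻¹ * ∑ s : Fin m → ℤˣ, A.sup' hA (fun a => ∑ i, ((s i : ℤ) : ℝ) * a i) ≤
      q / t + t * c ^ 2 * m / 2 := by
  set Q : ℝ := q + t ^ 2 * c ^ 2 * m / 2 with hQ
  -- The tangent line inequality `y ≤ Q - 1 + exp (y - Q)` takes the place of Jensen's inequality.
  have hpt : ∀ s : Fin m → ℤˣ, t * A.sup' hA (fun a => ∑ i, ((s i : ℤ) : ℝ) * a i) ≤
      Q - 1 + Real.exp (-Q) * ∑ a ∈ A, Real.exp (t * ∑ i, ((s i : ℤ) : ℝ) * a i) := by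
    intro s
    obtain ⟨a, haA, hae⟩ := Finset.exists_mem_eq_sup' hA (fun a => ∑ i, ((s i : ℤ) : ℝ) * a i)
    rw [hae]
    have h1 : Real.exp (t * ∑ i, ((s i : ℤ) : ℝ) * a i) ≤
        ∑ a ∈ A, Real.exp (t * ∑ i, ((s i : ℤ) : ℝ) * a i) :=
      Finset.single_le_sum (f := fun a => Real.exp (t * ∑ i, ((s i : ℤ) : ℝ) * a i))
        (fun _ _ => (Real.exp_pos _).le) haA
    have h2 := mul_le_mul_of_nonneg_left h1 (Real.exp_pos (-Q)).le
    rw [← Real.exp_add] at h2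
    have h3 := Real.add_one_le_exp (-Q + t * ∑ i, ((s i : ℤ) : ℝ) * a i)
    linarith
  have hcard : ((2 : ℝ) ^ m)⁻¹ * ∑ _s : Fin m → ℤˣ, (1 : ℝ) = 1 := by
    simp
  have hsum := Finset.sum_le_sum fun s (_ : s ∈ Finset.univ) => hpt s
  rw [← Finset.mul_sum, Finset.sum_add_distrib, ← Finset.mul_sum, Finset.sum_comm] at hsum
  have hexp : ((2 : ℝ) ^ m)⁻¹ * ∑ a ∈ A, ∑ s : Fin m → ℤˣ,
      Real.exp (t * ∑ i, ((s i : ℤ) : ℝ) * a i) ≤ Real.exp Q := by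
    rw [Finset.mul_sum]
    calc _ ≤ ∑ a ∈ A, Real.exp (t ^ 2 * c ^ 2 * m / 2) :=
          Finset.sum_le_sum fun a ha => sum_exp_signs_le a (hc a ha) t
      _ = A.card * Real.exp (t ^ 2 * c ^ 2 * m / 2) := by simp
      _ ≤ Real.exp q * Real.exp (t ^ 2 * c ^ 2 * m / 2) := by gcongr
      _ = Real.exp Q := by rw [hQ, Real.exp_add]
  have h4 : t * (((2 : ℝ) ^ m)⁻¹ * ∑ s : Fin m → ℤˣ,
      A.sup' hA (fun a => ∑ i, ((s i : ℤ) : ℝ) * a i)) ≤ Q := by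
    have h5 := mul_le_mul_of_nonneg_left hsum (by positivity : (0 : ℝ) ≤ ((2 : ℝ) ^ m)⁻¹)
    have h6 := mul_le_mul_of_nonneg_left hexp (Real.exp_pos (-Q)).le
    rw [← Real.exp_add, neg_add_cancel, Real.exp_zero] at h6
    have h7 : ∑ _s : Fin m → ℤˣ, (Q - 1) = (Q - 1) * ∑ _s : Fin m → ℤˣ, (1 : ℝ) := by
      rw [Finset.mul_sum]; simp
    rw [h7] at h5
    have h8 : ((2 : ℝ) ^ m)⁻¹ * ((Q - 1) * ∑ _s : Fin m → ℤˣ, (1 : ℝ)) = Q - 1 := by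
      rw [mul_left_comm, hcard, mul_one]
    linarith
  have h9 : q / t + t * c ^ 2 * m / 2 = Q / t := by
    rw [hQ]; field_simp
  rw [h9, le_div_iff₀ ht]
  linarith

/-- Massart's finite class lemma. -/
theorem massart {m : ℕ} (hm : 0 < m) (A : Finset (Fin m → ℝ)) (hA : A.Nonempty) {c q : ℝ}
    (hc : ∀ a ∈ A, ∀ i, |a i| ≤ c) (hq : (A.card : ℝ) ≤ Real.exp q) (hq0 : 0 < q) :
    ((2 : ℝ) ^ m)⁻¹ * ∑ s : Fin m → ℤˣ, A.sup' hA (fun a => ∑ i, ((s i : ℤ) : ℝ) * a i) ≤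
      c * Real.sqrt (2 * m * q) := by
  have hm' : (0 : ℝ) < m := by exact_mod_cast hm
  obtain ⟨a₀, ha₀⟩ := hA
  have hc0 : 0 ≤ c := (abs_nonneg _).trans (hc a₀ ha₀ ⟨0, hm⟩)
  rcases hc0.eq_or_lt with rfl | hcpos
  · have hz : ∀ s : Fin m → ℤˣ,
        A.sup' ⟨a₀, ha₀⟩ (fun a => ∑ i, ((s i : ℤ) : ℝ) * a i) ≤ 0 := by
      intro s
      refine Finset.sup'_le _ _ fun a ha => ?_
      refine Finset.sum_nonpos fun i _ => ?_
      rw [abs_nonpos_iff.1 (hc a ha i), mul_zero]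
    rw [zero_mul]
    exact mul_nonpos_of_nonneg_of_nonpos (by positivity) (Finset.sum_nonpos fun s _ => hz s)
  · set r := Real.sqrt (2 * m * q) with hr
    have hrpos : 0 < r := Real.sqrt_pos.2 (by positivity)
    have hr2 : r ^ 2 = 2 * m * q := Real.sq_sqrt (by positivity)
    -- This `t` minimizes `q / t + t * c ^ 2 * m / 2`; it needs `c ≠ 0`.
    refine (massart_aux A ⟨a₀, ha₀⟩ hc hq (t := r / (c * m)) (by positivity)).trans ?_
    have e1 : q = r ^ 2 / (2 * m) := by rw [hr2]; field_simp
    have e2 : q / (r / (c * m)) = c * r / 2 := by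
      rw [e1]; field_simp
    rw [e2]
    apply le_of_eq
    field_simp
    ring

/-! ### Dimension-free covers in sup norm -/

/-- The linear combination of the vectors `z` encoded by a word of indices and signs. -/
noncomputable def wordVector {E ι : Type*} [NormedAddCommGroup E] [InnerProductSpace ℝ E]
    (z : ι → E) (η : ℝ) {N : ℕ} (u : Fin N → ι × SignType) : E :=
  ∑ t, (η * ((u t).2 : ℝ)) • z (u t).1

theorem wordVector_cons {E ι : Type*} [NormedAddCommGroup E] [InnerProductSpace ℝ E]
    (z : ι → E) (η : ℝ) {N : ℕ} (p : ι × SignType) (u : Fin N → ι × SignType) :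
    wordVector z η (Fin.cons p u : Fin (N + 1) → ι × SignType) =
      (η * (p.2 : ℝ)) • z p.1 + wordVector z η u := by
  simp [wordVector, Fin.sum_univ_succ]

/-- The perceptron argument: each correction by a badly approximated vector `z i` decreases the
squared distance to `w` by at least `δ ^ 2 / b ^ 2`. -/
theorem exists_word_or_decrease {E ι : Type*} [NormedAddCommGroup E] [InnerProductSpace ℝ E]
    [Nonempty ι] (z : ι → E) {b δ : ℝ} (hb : 0 < b) (hδ : 0 < δ) (hz : ∀ i, ‖z i‖ ≤ b)
    (w : E) (N : ℕ) :
    ∃ u : Fin N → ι × SignType,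
      (∀ i, |inner ℝ (w - wordVector z (δ / b ^ 2) u) (z i)| ≤ δ) ∨
        ‖w - wordVector z (δ / b ^ 2) u‖ ^ 2 ≤ ‖w‖ ^ 2 - N * (δ ^ 2 / b ^ 2) := by
  induction N with
  | zero => exact ⟨Fin.elim0, Or.inr (by simp [wordVector])⟩
  | succ N ih =>
    obtain ⟨u, hu⟩ := ih
    set v := w - wordVector z (δ / b ^ 2) u with hv
    by_cases hgood : ∀ i, |inner ℝ v (z i)| ≤ δ
    -- A letter of sign `0` is padding, so that all words have length exactly `N`.
    · refine ⟨Fin.cons (Classical.arbitrary ι, 0) u, Or.inl ?_⟩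
      rw [wordVector_cons]
      simpa using hgood
    · have hdec := hu.resolve_left hgood
      push Not at hgood
      obtain ⟨i, hi⟩ := hgood
      refine ⟨Fin.cons (i, SignType.sign (inner ℝ v (z i))) u, Or.inr ?_⟩
      rw [wordVector_cons]
      have e : w - ((δ / b ^ 2 * ((SignType.sign (inner ℝ v (z i)) : SignType) : ℝ)) • z i +
          wordVector z (δ / b ^ 2) u) =
          v - (δ / b ^ 2 * ((SignType.sign (inner ℝ v (z i)) : SignType) : ℝ)) • z i := by
        rw [hv]; abel
      rw [e, norm_sub_sq_real, real_inner_smul_right, norm_smul, mul_pow, Real.norm_eq_abs,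
        sq_abs, mul_assoc (δ / b ^ 2), sign_mul_self]
      have hs : ((SignType.sign (inner ℝ v (z i)) : SignType) : ℝ) ^ 2 ≤ 1 := by
        rcases SignType.sign (inner ℝ v (z i)) with _ | _ | _ <;> simp
      have h1 : (δ / b ^ 2 * ((SignType.sign (inner ℝ v (z i)) : SignType) : ℝ)) ^ 2 * ‖z i‖ ^ 2
          ≤ (δ / b ^ 2) ^ 2 * b ^ 2 := by
        rw [mul_pow]
        have h2 : ‖z i‖ ^ 2 ≤ b ^ 2 := by gcongr; exact hz i
        calc _ ≤ (δ / b ^ 2) ^ 2 * 1 * b ^ 2 := by gcongr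
          _ = _ := by ring
      -- With `η = δ / b ^ 2` the squared norm changes by at most `-2 * η * δ + η ^ 2 * b ^ 2 = -δ ^
      -- 2 / b ^ 2`.
      have h3 : δ / b ^ 2 * δ ≤ δ / b ^ 2 * |inner ℝ v (z i)| := by gcongr
      have h4 : (δ / b ^ 2) ^ 2 * b ^ 2 = δ ^ 2 / b ^ 2 := by field_simp
      have h5 : δ / b ^ 2 * δ = δ ^ 2 / b ^ 2 := by ring
      push_cast
      linarith

/-- Sup-norm covers of linear functions on the ball of radius `B`. -/
theorem exists_cover {E ι : Type*} [NormedAddCommGroup E] [InnerProductSpace ℝ E]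
    [Fintype ι] [Nonempty ι] (z : ι → E) {b B : ℝ} (hb : 0 < b) (hB : 0 < B)
    (hz : ∀ i, ‖z i‖ ≤ b) (k : ℕ) :
    ∃ T : Finset E, (k = 0 → T = {0}) ∧ T.card ≤ (3 * Fintype.card ι) ^ 4 ^ k ∧
      ∀ w : E, ‖w‖ ≤ B → ∃ v ∈ T, ∀ i, |inner ℝ (w - v) (z i)| ≤ B * b / 2 ^ k := by
  classical
  rcases Nat.eq_zero_or_pos k with rfl | hk
  · refine ⟨{0}, fun _ => rfl, ?_, fun w hw => ⟨0, by simp, fun i => ?_⟩⟩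
    · have := Fintype.card_pos (α := ι)
      simp only [Finset.card_singleton, pow_zero, pow_one]
      omega
    · rw [sub_zero, pow_zero, div_one]
      exact (abs_real_inner_le_norm _ _).trans (mul_le_mul hw (hz i) (norm_nonneg _) hB.le)
  · have hδ : 0 < B * b / 2 ^ k := by positivity
    refine ⟨Finset.univ.image (fun u : Fin (4 ^ k) → ι × SignType =>
      wordVector z (B * b / 2 ^ k / b ^ 2) u), fun h => absurd h hk.ne', ?_, fun w hw => ?_⟩
    · refine Finset.card_image_le.trans (le_of_eq ?_)
      rw [Finset.card_univ, Fintype.card_fun, Fintype.card_fin, Fintype.card_prod, mul_comm]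
      rfl
    · obtain ⟨u, hu⟩ := exists_word_or_decrease z hb hδ hz w (4 ^ k)
      refine ⟨_, Finset.mem_image_of_mem _ (Finset.mem_univ u), ?_⟩
      rcases hu with hu | hu
      · exact hu
      -- `4 ^ k` decreases use up all of `B ^ 2`, so the residual vanishes.
      · have e : ((4 ^ k : ℕ) : ℝ) * ((B * b / 2 ^ k) ^ 2 / b ^ 2) = B ^ 2 := by
          have : (4 : ℝ) ^ k = (2 ^ k) ^ 2 := by
            rw [← pow_mul, mul_comm, pow_mul]; norm_num
          push_cast
          rw [this]
          field_simp
        have h1 : ‖w‖ ^ 2 ≤ B ^ 2 := by gcongr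
        have h2 : w - wordVector z (B * b / 2 ^ k / b ^ 2) u = 0 := by
          rw [← norm_eq_zero, ← sq_eq_zero_iff]
          exact le_antisymm (by linarith) (sq_nonneg _)
        intro i
        rw [h2, inner_zero_left, abs_zero]
        exact hδ.le

/-! ### Chaining -/

/-- Dudley-type chaining for a family of vectors `g v` whose increments are controlled by the linear
functions `v ↦ ⟪v, z i⟫`. -/
theorem exists_chaining_bound {E ι : Type*} [NormedAddCommGroup E] [InnerProductSpace ℝ E]
    [Fintype ι] [Nonempty ι] {m : ℕ} (hm : 0 < m) (z : ι → E) {b B L : ℝ} (hb : 0 < b)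
    (hB : 0 < B) (hz : ∀ i, ‖z i‖ ≤ b) (g : E → Fin m → ℝ) (hg0 : g 0 = 0)
    (hg : ∀ v v' r, (∀ i, |inner ℝ (v - v') (z i)| ≤ r) → ∀ j, |g v j - g v' j| ≤ L * r)
    (K : ℕ) :
    ∃ M : (Fin m → ℤˣ) → ℝ,
      (∀ s w, ‖w‖ ≤ B → ∑ i, ((s i : ℤ) : ℝ) * g w i ≤ M s) ∧
      ((2 : ℝ) ^ m)⁻¹ * ∑ s, M s ≤ m * (L * (B * b / 2 ^ K)) +
        K * (3 / 2 * (L * (B * b)) * Real.sqrt (10 * m * Real.log (3 * Fintype.card ι))) := by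
  classical
  choose T hT0 hTcard hTcov using exists_cover z hb hB hz
  choose π hπT hπ using fun (k : ℕ) (w : {w : E // ‖w‖ ≤ B}) => hTcov k w.1 w.2
  have hn1 : (1 : ℝ) ≤ Fintype.card ι := by exact_mod_cast Fintype.card_pos (α := ι)
  set ℓ := Real.log (3 * Fintype.card ι) with hℓ
  have hℓpos : 0 < ℓ := Real.log_pos (by linarith)
  have hpart : ∀ K : ℕ, ∃ M : (Fin m → ℤˣ) → ℝ,
      (∀ s w, ∑ i, ((s i : ℤ) : ℝ) * g (π K w) i ≤ M s) ∧
      ((2 : ℝ) ^ m)⁻¹ * ∑ s, M s ≤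
        K * (3 / 2 * (L * (B * b)) * Real.sqrt (10 * m * ℓ)) := by
    intro K
    induction K with
    | zero =>
      refine ⟨fun _ => 0, fun s w => ?_, by simp⟩
      -- The coarsest net is `{0}`, so the chain starts at `g 0 = 0` at no cost.
      have : π 0 w = 0 := by
        have := hπT 0 w
        rwa [hT0 0 rfl, Finset.mem_singleton] at this
      simp [this, hg0]
    | succ k ih =>
      obtain ⟨M, hM, hMsum⟩ := ih
      -- The filter discards pairs of net points too far apart to approximate a common `w`; Massart
      -- needs a bound on all of `A`. The factor `3 / 2` is `1 + 1 / 2`, from two consecutive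
      -- scales.
      set A : Finset (Fin m → ℝ) := ((T k ×ˢ T (k + 1)).image
        (fun p => g p.2 - g p.1)).filter
          (fun a => ∀ i, |a i| ≤ 3 / 2 * (L * (B * b)) / 2 ^ k) with hAdef
      have hmem : ∀ w, g (π (k + 1) w) - g (π k w) ∈ A := by
        intro w
        refine Finset.mem_filter.2 ⟨Finset.mem_image.2 ⟨(π k w, π (k + 1) w),
          Finset.mem_product.2 ⟨hπT _ _, hπT _ _⟩, rfl⟩, fun i => ?_⟩
        refine (hg _ _ (B * b / 2 ^ k + B * b / 2 ^ (k + 1)) (fun i => ?_) i).trans (le_of_eq ?_)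
        · have e : π (k + 1) w - π k w = (w.1 - π k w) - (w.1 - π (k + 1) w) := by abel
          rw [e, inner_sub_left]
          exact (abs_sub _ _).trans (add_le_add (hπ k w i) (hπ (k + 1) w i))
        · rw [pow_succ]; field_simp; norm_num
      have hAne : A.Nonempty := ⟨_, hmem ⟨0, by simpa using hB.le⟩⟩
      have hcard : (A.card : ℝ) ≤ Real.exp (5 * 4 ^ k * ℓ) := by
        have h1 : A.card ≤ (3 * Fintype.card ι) ^ (5 * 4 ^ k) := by
          calc A.card ≤ (T k ×ˢ T (k + 1)).card :=
                (Finset.card_filter_le _ _).trans Finset.card_image_le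
            _ ≤ (3 * Fintype.card ι) ^ 4 ^ k * (3 * Fintype.card ι) ^ 4 ^ (k + 1) := by
                rw [Finset.card_product]
                exact Nat.mul_le_mul (hTcard k) (hTcard (k + 1))
            _ = _ := by rw [← pow_add]; congr 1; ring
        have h2 : Real.exp (5 * 4 ^ k * ℓ) = (3 * (Fintype.card ι : ℝ)) ^ (5 * 4 ^ k) := by
          have : (5 * 4 ^ k * ℓ : ℝ) = ((5 * 4 ^ k : ℕ) : ℝ) * ℓ := by push_cast; ring
          rw [this, Real.exp_nat_mul, hℓ, Real.exp_log (by linarith)]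
        rw [h2]
        exact_mod_cast h1
      have hmas := massart hm A hAne (c := 3 / 2 * (L * (B * b)) / 2 ^ k)
        (fun a ha => (Finset.mem_filter.1 ha).2) hcard (by positivity)
      refine ⟨fun s => M s + A.sup' hAne (fun a => ∑ i, ((s i : ℤ) : ℝ) * a i),
        fun s w => ?_, ?_⟩
      · have h1 := Finset.le_sup' (fun a : Fin m → ℝ => ∑ i, ((s i : ℤ) : ℝ) * a i) (hmem w)
        have h2 := hM s w
        simp only [Pi.sub_apply, mul_sub, Finset.sum_sub_distrib] at h1
        linarith
      · rw [Finset.sum_add_distrib, mul_add]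
        have hs : 3 / 2 * (L * (B * b)) / 2 ^ k * Real.sqrt (2 * m * (5 * 4 ^ k * ℓ)) =
            3 / 2 * (L * (B * b)) * Real.sqrt (10 * m * ℓ) := by
          have h4 : (4 : ℝ) ^ k = (2 ^ k) ^ 2 := by
            rw [← pow_mul, mul_comm, pow_mul]; norm_num
          have : (2 * m * (5 * 4 ^ k * ℓ) : ℝ) = (2 ^ k) ^ 2 * (10 * m * ℓ) := by
            rw [h4]; ring
          rw [this, Real.sqrt_mul (by positivity), Real.sqrt_sq (by positivity)]
          field_simp
        rw [hs] at hmas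
        push_cast
        linarith
  obtain ⟨M, hM, hMsum⟩ := hpart K
  refine ⟨fun s => m * (L * (B * b / 2 ^ K)) + M s, fun s w hw => ?_, ?_⟩
  · have h1 := hM s ⟨w, hw⟩
    have h2 : ∑ i, ((s i : ℤ) : ℝ) * (g w i - g (π K ⟨w, hw⟩) i) ≤
        ∑ _i : Fin m, L * (B * b / 2 ^ K) := by
      refine Finset.sum_le_sum fun i _ => ?_
      refine (le_abs_self _).trans ?_
      have hs : |((s i : ℤ) : ℝ)| = 1 := by
        rcases Int.units_eq_one_or (s i) with h | h <;> simp [h]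
      rw [abs_mul, hs, one_mul]
      exact hg _ _ _ (hπ K ⟨w, hw⟩) i
    simp only [mul_sub, Finset.sum_sub_distrib] at h2
    simp only [Finset.sum_const, Finset.card_univ, Fintype.card_fin, nsmul_eq_mul] at h2
    linarith
  · rw [Finset.sum_add_distrib, mul_add]
    have : ((2 : ℝ) ^ m)⁻¹ * ∑ _s : Fin m → ℤˣ, (m * (L * (B * b / 2 ^ K)) : ℝ) =
        m * (L * (B * b / 2 ^ K)) := by
      simp
    rw [this]
    linarith

/-! ### The convolutional class -/

/-- To bound a Rademacher complexity by a real number it is enough to bound the suprema for every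
choice of inputs and signs by real numbers with a small average. -/
theorem rademacherComplexity_le {E : Type*} {F : Set (E → ℝ)} {S : Set E} {m : ℕ} {R : ℝ}
    (h : ∀ x : Fin m → E, (∀ i, x i ∈ S) → ∃ M : (Fin m → ℤˣ) → ℝ,
      (∀ s, ∀ f ∈ F, (1 / (m : ℝ)) * ∑ i, ((s i : ℤ) : ℝ) * f (x i) ≤ M s) ∧
      ((2 : ℝ) ^ m)⁻¹ * ∑ s, M s ≤ R) :
    rademacherComplexity F S m ≤ (R : EReal) := by
  refine iSup₂_le fun x hx => ?_
  obtain ⟨M, hM, hsum⟩ := h x hx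
  have hcoe : ∀ A : Finset (Fin m → ℤˣ), ((∑ s ∈ A, M s : ℝ) : EReal) = ∑ s ∈ A, (M s : EReal) := by
    classical
    intro A
    induction A using Finset.induction_on with
    | empty => simp
    | insert a A ha ih => rw [Finset.sum_insert ha, Finset.sum_insert ha, EReal.coe_add, ih]
  calc _ ≤ ((((2 : ℝ) ^ m)⁻¹ : ℝ) : EReal) * ∑ s : Fin m → ℤˣ, (M s : EReal) := by
        refine mul_le_mul_of_nonneg_left (Finset.sum_le_sum fun s _ => ?_)
          (EReal.coe_nonneg.2 (by positivity))
        exact iSup₂_le fun f hf => EReal.coe_le_coe_iff.2 (hM s f hf)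
    _ = ((((2 : ℝ) ^ m)⁻¹ * ∑ s, M s : ℝ) : EReal) := by rw [EReal.coe_mul, hcoe]
    _ ≤ R := EReal.coe_le_coe_iff.2 hsum

/-- The filter of a conforming matrix has Euclidean norm at most the spectral norm. -/
theorem norm_filter_le {n d n' : ℕ} (hn : 0 < n) {W : Matrix (Fin n) (Fin d) ℝ}
    {Φ : Fin n → Fin n' ↪ Fin d} {w : EuclideanSpace ℝ (Fin n')}
    (hw : ∀ (x : EuclideanSpace ℝ (Fin d)) (j : Fin n),
      (W *ᵥ x.ofLp) j = inner ℝ w (patchMap (Φ j) x)) :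
    ‖w‖ ≤ matrixSpectralNorm W := by
  set p := Φ ⟨0, hn⟩ with hp
  -- Extending `w` by zero off one patch gives an input of the same norm on which that output
  -- coordinate is `‖w‖ ^ 2`.
  set x : EuclideanSpace ℝ (Fin d) := WithLp.toLp 2 (Function.extend p w.ofLp 0) with hx
  have hpx : patchMap p x = w := by
    ext k
    simp [patchMap, hx, p.injective.extend_apply]
  have hnorm : ‖x‖ = ‖w‖ := by
    rw [EuclideanSpace.norm_eq, EuclideanSpace.norm_eq]
    congr 1
    symm
    refine Finset.sum_of_injOn p p.injective.injOn (fun _ _ => Finset.mem_coe.2 (Finset.mem_univ _))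
      (fun i _ hi => ?_) (fun k _ => ?_)
    · have : ¬ ∃ k, p k = i := fun ⟨k, hk⟩ => hi ⟨k, by simp, hk⟩
      simp [hx, Function.extend_apply' _ _ _ this]
    · simp [hx, p.injective.extend_apply]
  have h1 : ‖w‖ ^ 2 = (W *ᵥ x.ofLp) ⟨0, hn⟩ := by
    rw [hw, ← hp, hpx, real_inner_self_eq_norm_sq]
  have h2 : ‖Matrix.toEuclideanLin W x‖ ≤ matrixSpectralNorm W * ‖x‖ :=
    (LinearMap.toContinuousLinearMap (Matrix.toEuclideanLin W)).le_opNorm x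
  have h3 : (W *ᵥ x.ofLp) ⟨0, hn⟩ ≤ ‖Matrix.toEuclideanLin W x‖ :=
    (le_abs_self _).trans (PiLp.norm_apply_le (Matrix.toEuclideanLin W x) ⟨0, hn⟩)
  rcases (norm_nonneg w).eq_or_lt with h0 | h0
  · rw [← h0]
    exact norm_nonneg _
  · rw [hnorm] at h2
    refine le_of_mul_le_mul_right ?_ h0
    rw [← sq]
    linarith

/-- Bound on the Rademacher complexity of the convolutional class by chaining over `K` scales. -/
theorem rademacherComplexity_convClass_le {n d n' : ℕ} {B b : ℝ} {L : ℝ≥0} {σ : ℝ → ℝ}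
    {ρ : (Fin n → ℝ) → ℝ} (Φ : Fin n → Fin n' ↪ Fin d) {m : ℕ} (hn : 0 < n) (hB : 0 < B)
    (hb : 0 < b) (hσ : LipschitzWith L σ) (hσ0 : σ 0 = 0) (hρ : LipschitzWith 1 ρ)
    (hρ0 : ρ 0 = 0) (hm : 0 < m) (K : ℕ) :
    rademacherComplexity (convClass σ ρ Φ B) (patchBall Φ b) m ≤
      ((L * B * b * (1 / 2 ^ K + K * (3 / 2 *
        Real.sqrt (10 * Real.log (3 * (m * n)) / m))) : ℝ) : EReal) := by
  have hm' : (0 : ℝ) < m := by exact_mod_cast hm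
  refine rademacherComplexity_le fun x hx => ?_
  have : Nonempty (Fin m × Fin n) := ⟨(⟨0, hm⟩, ⟨0, hn⟩)⟩
  obtain ⟨M, hM, hsum⟩ := exists_chaining_bound (L := L) hm
    (fun q : Fin m × Fin n => patchMap (Φ q.2) (x q.1)) hb hB (fun q => hx q.1 q.2)
    (fun (w : EuclideanSpace ℝ (Fin n')) i =>
      ρ (fun j => σ (inner ℝ w (patchMap (Φ j) (x i)))))
    (by
      funext i
      simp only [inner_zero_left, hσ0]
      exact hρ0)
    (by
      intro v v' r hr i
      have hr0 : 0 ≤ r := (abs_nonneg _).trans (hr (⟨0, hm⟩, ⟨0, hn⟩))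
      rw [← Real.dist_eq]
      refine (hρ.dist_le_mul _ _).trans ?_
      rw [NNReal.coe_one, one_mul]
      refine (dist_pi_le_iff (by positivity)).2 fun j => ?_
      refine (hσ.dist_le_mul _ _).trans ?_
      rw [Real.dist_eq, ← inner_sub_left]
      exact mul_le_mul_of_nonneg_left (hr (i, j)) L.2) K
  refine ⟨fun s => (1 / (m : ℝ)) * M s, ?_, ?_⟩
  · rintro s f ⟨W, hW, ⟨w, hw⟩, rfl⟩
    refine mul_le_mul_of_nonneg_left ?_ (by positivity)
    simp only [hw]
    exact hM s w ((norm_filter_le hn hw).trans hW)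
  · rw [← Finset.mul_sum, mul_left_comm]
    refine (mul_le_mul_of_nonneg_left hsum (by positivity)).trans (le_of_eq ?_)
    simp only [Fintype.card_prod, Fintype.card_fin, Nat.cast_mul]
    have e : (10 * m * Real.log (3 * (m * n)) : ℝ) =
        m ^ 2 * (10 * Real.log (3 * (m * n)) / m) := by
      field_simp
    rw [e, Real.sqrt_mul (by positivity), Real.sqrt_sq hm'.le]
    field_simp

/-! ### Sample size -/

/-- The number of scales `K = ⌈log₄ m⌉` balances the two terms of the chaining bound. -/
theorem chaining_bound_le {m n : ℕ} (hm : 2 ≤ m) (hn : 0 < n) :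
    ∃ K : ℕ, 1 / 2 ^ K + K * (3 / 2 * Real.sqrt (10 * Real.log (3 * (m * n)) / m)) ≤
      Real.sqrt (1000 * Real.log m ^ 2 * Real.log (m * n) / m) := by
  have hm2 : (2 : ℝ) ≤ m := by exact_mod_cast hm
  have hm0 : (0 : ℝ) < m := by linarith
  have hn1 : (1 : ℝ) ≤ n := by exact_mod_cast hn
  have hmn : (2 : ℝ) ≤ m * n := by nlinarith
  have hlog2 : (0.69 : ℝ) ≤ Real.log 2 := by linarith [Real.log_two_gt_d9]
  set ℓ := Real.log m with hℓ
  set u := Real.log (m * n) with hu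
  have hℓ2 : 0.69 ≤ ℓ := hlog2.trans (Real.log_le_log (by norm_num) hm2)
  have hu2 : 0.69 ≤ u := hlog2.trans (Real.log_le_log (by norm_num) hmn)
  have h3u : Real.log (3 * (m * n)) ≤ 3 * u := by
    have : 3 * u = Real.log ((m * n : ℝ) ^ 3) := by rw [Real.log_pow, hu]; push_cast; rfl
    rw [this]
    refine Real.log_le_log (by positivity) ?_
    nlinarith [mul_self_nonneg ((m : ℝ) * n - 2)]
  refine ⟨Nat.clog 4 m, ?_⟩
  set K := Nat.clog 4 m with hK
  have hK1 : (m : ℝ) ≤ (2 ^ K) ^ 2 := by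
    have h1 : m ≤ 4 ^ K := Nat.le_pow_clog (by norm_num) m
    rw [← pow_mul, mul_comm, pow_mul]
    exact_mod_cast h1
  have hK2 : (K : ℝ) ≤ 3 * ℓ := by
    have hKpos : 0 < K := Nat.clog_pos (by norm_num) hm
    have h1 : 4 ^ (K - 1) < m := Nat.pow_pred_clog_lt_self (by norm_num) hm
    have h2 : Real.log ((4 : ℝ) ^ (K - 1)) ≤ ℓ :=
      Real.log_le_log (by positivity) (by exact_mod_cast h1.le)
    have h4 : Real.log 4 = 2 * Real.log 2 := by
      rw [show (4 : ℝ) = 2 ^ 2 by norm_num, Real.log_pow]; norm_num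
    rw [Real.log_pow, h4, Nat.cast_sub hKpos, Nat.cast_one] at h2
    have hK1' : (1 : ℝ) ≤ K := by exact_mod_cast hKpos
    nlinarith
  set r := Real.sqrt (u / m) with hr
  have hr0 : 0 ≤ r := Real.sqrt_nonneg _
  have hsq : r ^ 2 = u / m := Real.sq_sqrt (by positivity)
  -- `5.5 ^ 2 ≥ 30 = 10 * 3`, the `3` coming from `h3u`.
  have hA : Real.sqrt (10 * Real.log (3 * (m * n)) / m) ≤ 5.5 * r := by
    refine Real.sqrt_le_iff.2 ⟨by positivity, ?_⟩
    rw [mul_pow, hsq, div_le_iff₀ hm0, mul_assoc, div_mul_cancel₀ _ hm0.ne']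
    linarith
  have hB : 1 / 2 ^ K ≤ 2 * ℓ * r := by
    refine le_of_sq_le_sq ?_ (by positivity)
    rw [mul_pow, hsq, div_pow, one_pow, div_le_iff₀ (by positivity)]
    have h1 : 1 ≤ (2 * ℓ) ^ 2 * u := by nlinarith
    calc (1 : ℝ) ≤ (2 * ℓ) ^ 2 * u := h1
      _ = (2 * ℓ) ^ 2 * (u / m) * m := by field_simp
      _ ≤ (2 * ℓ) ^ 2 * (u / m) * (2 ^ K) ^ 2 := by gcongr
  refine Real.le_sqrt_of_sq_le ?_
  have hT : 1 / 2 ^ K + K * (3 / 2 * Real.sqrt (10 * Real.log (3 * (m * n)) / m)) ≤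
      26.75 * (ℓ * r) := by
    calc _ ≤ 2 * ℓ * r + 3 * ℓ * (3 / 2 * (5.5 * r)) := by gcongr
      _ = 26.75 * (ℓ * r) := by ring
  calc _ ≤ (26.75 * (ℓ * r)) ^ 2 := by gcongr
    _ = 26.75 ^ 2 * (ℓ ^ 2 * (u / m)) := by rw [mul_pow, mul_pow, hsq]
    _ ≤ 1000 * (ℓ ^ 2 * (u / m)) := by gcongr; norm_num
    _ = _ := by ring

/-- The self-referential sample size condition follows from an explicit one. -/
theorem sample_size_of_explicit {A m n : ℝ} (hA : 0 ≤ A) (hm : 1 ≤ m) (hn : 1 ≤ n)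
    (h : 10 ^ 22 * A * Real.log (2 + A + n) ^ 3 ≤ m) :
    1000 * A * Real.log m ^ 2 * Real.log (m * n) ≤ m := by
  set u := Real.log (2 + A + n) with hu
  set ℓ := Real.log m with hℓ
  have hℓ0 : 0 ≤ ℓ := Real.log_nonneg hm
  have hu1 : 1 ≤ u := by
    rw [hu, Real.le_log_iff_exp_le (by linarith)]
    linarith [Real.exp_one_lt_d9]
  have hnu : Real.log n ≤ u := Real.log_le_log (by linarith) (by linarith)
  have hmul : Real.log (m * n) ≤ ℓ + u := by
    rw [Real.log_mul (by linarith) (by linarith)]; linarith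
  have h1 : 1000 * A * ℓ ^ 2 * Real.log (m * n) ≤ 1000 * A * ℓ ^ 2 * (ℓ + u) := by gcongr
  refine h1.trans ?_
  -- If `ℓ` is at most a multiple of `u`, the hypothesis `h` suffices. Otherwise both `A ≤ exp u`
  -- and the polynomial in the logarithms are at most `√m = exp (ℓ / 2)`.
  rcases le_total ℓ (10 ^ 6 * u) with hcase | hcase
  · calc 1000 * A * ℓ ^ 2 * (ℓ + u) ≤ 1000 * A * (10 ^ 6 * u) ^ 2 * (10 ^ 6 * u + u) := by gcongr
      _ = (1000 * 10 ^ 12 * (10 ^ 6 + 1)) * (A * u ^ 3) := by ring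
      _ ≤ 10 ^ 22 * (A * u ^ 3) := by gcongr; norm_num
      _ = 10 ^ 22 * A * u ^ 3 := by ring
      _ ≤ m := h
  · have hA' : A ≤ Real.exp (ℓ / 2) := by
      calc A ≤ 2 + A + n := by linarith
        _ = Real.exp u := (Real.exp_log (by linarith)).symm
        _ ≤ _ := Real.exp_le_exp.2 (by linarith)
    have hexp : (ℓ / 2) ^ 4 / 24 ≤ Real.exp (ℓ / 2) := by
      have := Real.pow_div_factorial_le_exp (ℓ / 2) (by linarith) 4
      norm_num [Nat.factorial] at this ⊢
      exact this
    have hℓbig : 10 ^ 6 ≤ ℓ := by linarith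
    have hpoly : 1000 * ℓ ^ 2 * (ℓ + u) ≤ (ℓ / 2) ^ 4 / 24 := by
      calc 1000 * ℓ ^ 2 * (ℓ + u) ≤ 1000 * ℓ ^ 2 * (ℓ + ℓ) := by gcongr; linarith
        _ = ℓ ^ 3 * 2000 := by ring
        _ ≤ ℓ ^ 3 * (ℓ / 384) := by gcongr; linarith
        _ = _ := by ring
    calc 1000 * A * ℓ ^ 2 * (ℓ + u) = A * (1000 * ℓ ^ 2 * (ℓ + u)) := by ring
      _ ≤ Real.exp (ℓ / 2) * Real.exp (ℓ / 2) :=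
          mul_le_mul hA' (hpoly.trans hexp) (by positivity) (Real.exp_pos _).le
      _ = m := by rw [← Real.exp_add, add_halves, Real.exp_log (by linarith)]

theorem rademacherComplexity_convClass_le_of_sample_size {n d n' : ℕ} {B b ε : ℝ} {L : ℝ≥0}
    {σ : ℝ → ℝ} {ρ : (Fin n → ℝ) → ℝ} (Φ : Fin n → Fin n' ↪ Fin d) {m : ℕ} (hn : 0 < n)
    (hB : 0 < B) (hb : 0 < b) (hε : 0 < ε) (hσ : LipschitzWith L σ) (hσ0 : σ 0 = 0)
    (hρ : LipschitzWith 1 ρ) (hρ0 : ρ 0 = 0) (hm : 2 ≤ m)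
    (h : 1000 * (L * B * b / ε) ^ 2 * Real.log m ^ 2 * Real.log (m * n) ≤ m) :
    rademacherComplexity (convClass σ ρ Φ B) (patchBall Φ b) m ≤ (ε : EReal) := by
  have hm0 : (0 : ℝ) < m := by exact_mod_cast (by omega : 0 < m)
  obtain ⟨K, hK⟩ := chaining_bound_le hm hn
  refine (rademacherComplexity_convClass_le Φ hn hB hb hσ hσ0 hρ hρ0 (by omega) K).trans
    (EReal.coe_le_coe_iff.2 ?_)
  have hD : 0 ≤ L * B * b := by positivity
  refine (mul_le_mul_of_nonneg_left hK hD).trans ?_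
  have hmn : (1 : ℝ) ≤ m * n := by exact_mod_cast Nat.mul_pos (by omega : 0 < m) hn
  have hlog : 0 ≤ Real.log (m * n) := Real.log_nonneg hmn
  refine le_of_sq_le_sq ?_ hε.le
  rw [mul_pow, Real.sq_sqrt (by positivity)]
  rw [div_pow] at h
  calc (L * B * b) ^ 2 * (1000 * Real.log m ^ 2 * Real.log (m * n) / m)
      = ε ^ 2 * (1000 * ((L * B * b) ^ 2 / ε ^ 2) * Real.log m ^ 2 * Real.log (m * n)) / m := by
        field_simp
    _ ≤ ε ^ 2 * m / m := by gcongr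
    _ = ε ^ 2 := by field_simp

theorem theorem7 :
    (∃ c : ℝ, 0 < c ∧
      ∀ (n d n' : ℕ) (B b_x ε : ℝ) (L : ℝ≥0) (σ : ℝ → ℝ) (ρ : (Fin n → ℝ) → ℝ)
        (Φ : Fin n → Fin n' ↪ Fin d) (m : ℕ),
        0 < n → 0 < d → 0 < B → 0 < b_x → 0 < ε →
        LipschitzWith L σ → σ 0 = 0 → LipschitzWith 1 ρ → ρ 0 = 0 →
        2 ≤ m →
        c * (L * B * b_x / ε) ^ 2 * (Real.log m) ^ 2 * Real.log (m * n) ≤ (m : ℝ) →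
        rademacherComplexity (convClass σ ρ Φ B) (patchBall Φ b_x) m ≤ (ε : EReal)) ∧
    (∃ (C : ℝ) (k : ℕ), 0 < C ∧
      ∀ (n d n' : ℕ) (B b_x ε : ℝ) (L : ℝ≥0) (σ : ℝ → ℝ) (ρ : (Fin n → ℝ) → ℝ)
        (Φ : Fin n → Fin n' ↪ Fin d) (m : ℕ),
        0 < n → 0 < d → 0 < B → 0 < b_x → 0 < ε →
        LipschitzWith L σ → σ 0 = 0 → LipschitzWith 1 ρ → ρ 0 = 0 →
        1 ≤ m →
        C * (L * B * b_x / ε) ^ 2 * (Real.log (2 + (L * B * b_x / ε) ^ 2 + n)) ^ k ≤ (m : ℝ) →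
        rademacherComplexity (convClass σ ρ Φ B) (patchBall Φ b_x) m ≤ (ε : EReal)) := by
  refine ⟨⟨1000, by norm_num, ?_⟩, ⟨10 ^ 22, 3, by norm_num, ?_⟩⟩
  · intro n d n' B b_x ε L σ ρ Φ m hn _ hB hb hε hσ hσ0 hρ hρ0 hm h
    exact rademacherComplexity_convClass_le_of_sample_size Φ hn hB hb hε hσ hσ0 hρ hρ0 hm h
  · intro n d n' B b_x ε L σ ρ Φ m hn _ hB hb hε hσ hσ0 hρ hρ0 hm h
    have hn1 : (1 : ℝ) ≤ n := by exact_mod_cast hn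
    have hm1 : (1 : ℝ) ≤ m := by exact_mod_cast hm
    -- For `m = 1`, chaining with `K = 0` leaves the trivial bound `L * B * b_x`, and `h` forces `A
    -- ≤ 1`.
    rcases hm.eq_or_lt with rfl | hm2
    · refine (rademacherComplexity_convClass_le Φ hn hB hb hσ hσ0 hρ hρ0 one_pos 0).trans
        (EReal.coe_le_coe_iff.2 ?_)
      set A := (L * B * b_x / ε) ^ 2 with hA
      have hA0 : 0 ≤ A := sq_nonneg _
      have hu : 1 ≤ Real.log (2 + A + n) := by
        rw [Real.le_log_iff_exp_le (by linarith)]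
        linarith [Real.exp_one_lt_d9]
      have hA1 : A ≤ 1 := by
        have h1 : 10 ^ 22 * A * 1 ≤ 10 ^ 22 * A * Real.log (2 + A + n) ^ 3 :=
          mul_le_mul_of_nonneg_left (one_le_pow₀ hu) (by positivity)
        rw [Nat.cast_one] at h
        linarith
      have h2 : L * B * b_x / ε ≤ 1 := by
        nlinarith
      rw [div_le_one hε] at h2
      simpa using h2
    · exact rademacherComplexity_convClass_le_of_sample_size Φ hn hB hb hε hσ hσ0 hρ hρ0 hm2
        (sample_size_of_explicit (sq_nonneg _) hm1 hn1 h)
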